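/- Let $g\in L^2(\mathbb R^d)$, $g\neq 0$. For $z=(x,\xi)\in\mathbb R^d\times\mathbb R^d=\mathbb R^{2d}$ let $\pi(z)f(t)=e^{2\pi i\xi\cdot t}f(t-x)$ be the time-frequency shift, and let $$V_g g(x,\xi)=\int_{\mathbb R^d} g(t)\,\overline{g(t-x)}\,e^{-2\pi i\xi\cdot t}\,dt$$ be the short-time Fourier transform of $g$ with respect to itself. Suppose that for some $s>2d$ and some constant $C$, $$|V_g g(z)|\le C(1+|z|)^{-s}\qquad\text{for all } z\in\mathbb R^{2d}.$$ Then there exists $\delta_0>0$, depending on $g$, such that for every invertible real $2d\times 2d$ matrix $A$ with $\|A\|_{op}<\delta_0$ (the operator norm induced by the Euclidean norm), the Gabor system $\mathcal G(g,\Lambda)=\{\pi(\lambda)g:\lambda\in\Lambda\}$ over the lattice $\Lambda=A\mathbb Z^{2d}$ is a frame for $L^2(\mathbb R^d)$; that is, there are constants $a,b>0$ such that $$a\|f\|_2^2\le\sum_{\lambda\in\Lambda}|\langle f,\pi(\lambda)g\rangle|^2\le b\|f\|_2^2\qquad\text{for all } f\in L^2(\mathbb R^d).$$ -/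

import Mathlib

open MeasureTheory

noncomputable section

namespace Gabor

/-- The configuration space `ℝ^d` with the Euclidean norm. -/
abbrev Space (d : ℕ) : Type := EuclideanSpace ℝ (Fin d)

/-- The time-frequency plane `ℝ^{2d}` with the Euclidean norm; the coordinates `Sum.inl i` are those
of the time variable and the coordinates `Sum.inr i` those of the frequency variable. -/
abbrev Phase (d : ℕ) : Type := EuclideanSpace ℝ (Fin d ⊕ Fin d)

/-- The Hilbert space `L²(ℝ^d)` for Lebesgue measure. -/
abbrev L2 (d : ℕ) : Type := Lp ℂ 2 (volume : Measure (Space d))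

/-- The time component `x` of `z = (x, ξ)`. -/
def Phase.time {d : ℕ} (z : Phase d) : Space d := WithLp.toLp 2 fun i => z (Sum.inl i)

/-- The frequency component `ξ` of `z = (x, ξ)`. -/
def Phase.freq {d : ℕ} (z : Phase d) : Space d := WithLp.toLp 2 fun i => z (Sum.inr i)

/-- The short-time Fourier transform
`V_g f (x, ξ) = ∫ f(t) conj(g(t - x)) exp(-2πi ξ·t) dt`. -/
def stft {d : ℕ} (g f : L2 d) (z : Phase d) : ℂ :=
  ∫ t : Space d, f t * (starRingEnd ℂ) (g (t - z.time)) *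
    Complex.exp (-(2 * Real.pi * Complex.I * (inner ℝ z.freq t : ℝ)))

/-- The time-frequency shift on functions, `π(x, ξ) f (t) = exp(2πi ξ·t) f(t - x)`. -/
def tfShiftFun {d : ℕ} (z : Phase d) (f : Space d → ℂ) (t : Space d) : ℂ :=
  Complex.exp (2 * Real.pi * Complex.I * (inner ℝ z.freq t : ℝ)) * f (t - z.time)

theorem memLp_tfShiftFun {d : ℕ} (z : Phase d) {f : Space d → ℂ} (hf : MemLp f 2 volume) :
    MemLp (tfShiftFun z f) 2 volume := by
  have h1 : MemLp (fun t : Space d => f (t - z.time)) 2 volume :=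
    hf.comp_measurePreserving (measurePreserving_sub_right volume z.time)
  refine MemLp.of_le h1 ?_ (Filter.Eventually.of_forall fun t => ?_)
  · refine AEStronglyMeasurable.mul ?_ h1.aestronglyMeasurable
    exact Continuous.aestronglyMeasurable (by fun_prop)
  · have h2 : ‖Complex.exp (2 * Real.pi * Complex.I * (inner ℝ z.freq t : ℝ))‖ = 1 := by
      rw [Complex.norm_exp]
      simp
    simp only [tfShiftFun, norm_mul, h2, one_mul, le_refl]

/-- The time-frequency shift `π(z)` on `L²(ℝ^d)`. -/
def tfShift {d : ℕ} (z : Phase d) (f : L2 d) : L2 d :=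
  (memLp_tfShiftFun z (Lp.memLp f)).toLp (tfShiftFun z f)

/-- `g ∈ M^∞_{v_s}(ℝ^d)`: the bound `|V_g g(z)| ≤ C (1 + |z|)^{-s}` holds for some `C` and all
`z ∈ ℝ^{2d}`. -/
def MemModulation {d : ℕ} (s : ℝ) (g : L2 d) : Prop :=
  ∃ C : ℝ, ∀ z : Phase d, ‖stft g g z‖ ≤ C * (1 + ‖z‖) ^ (-s)

/-- The subgroup `A ℤ^{2d}` of `ℝ^{2d}`. It is a lattice when `A` is invertible. -/
def lattice {d : ℕ} (A : Matrix (Fin d ⊕ Fin d) (Fin d ⊕ Fin d) ℝ) : AddSubgroup (Phase d) where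
  carrier := {z | ∃ k : Fin d ⊕ Fin d → ℤ,
    z = Matrix.toEuclideanCLM (𝕜 := ℝ) A (WithLp.toLp 2 fun i => (k i : ℝ))}
  zero_mem' := ⟨0, by
    rw [Matrix.toEuclideanCLM_toLp]
    ext i
    simp [Matrix.mulVec, dotProduct]⟩
  add_mem' := by
    rintro _ _ ⟨k, rfl⟩ ⟨l, rfl⟩
    refine ⟨k + l, ?_⟩
    rw [← map_add]
    congr 1
    ext i
    simp
  neg_mem' := by
    rintro _ ⟨k, rfl⟩
    refine ⟨-k, ?_⟩
    rw [← map_neg]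
    congr 1
    ext i
    simp

/-- A family `(e_i)` in a complex inner product space is a frame if there are `a, b > 0` with
`a ‖f‖² ≤ ∑_i |⟨f, e_i⟩|² ≤ b ‖f‖²` for all `f`, the series being convergent. (Mathlib's inner
product is conjugate-linear in its first argument.) -/
def IsFrame {ι H : Type*} [NormedAddCommGroup H] [InnerProductSpace ℂ H] (e : ι → H) : Prop :=
  ∃ a b : ℝ, 0 < a ∧ 0 < b ∧ ∀ f : H,
    Summable (fun i => ‖inner ℂ (e i) f‖ ^ 2) ∧
    a * ‖f‖ ^ 2 ≤ ∑' i, ‖inner ℂ (e i) f‖ ^ 2 ∧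
    ∑' i, ‖inner ℂ (e i) f‖ ^ 2 ≤ b * ‖f‖ ^ 2

/-- The Gabor system `G(g, Λ) = (π(λ) g)_{λ ∈ Λ}`. -/
def gaborSystem {d : ℕ} (g : L2 d) (Λ : AddSubgroup (Phase d)) (l : Λ) : L2 d :=
  tfShift (l : Phase d) g

end Gabor

end

noncomputable section

namespace Gabor

open scoped FourierTransform ENNReal Topology

/-! Moyal's identity says that `∫ |V_g f|² = ‖f‖² ‖g‖²`. Cut the plane into translates `λ + Q` of a
fundamental domain `Q` of the lattice. Up to a phase, `V_g f (λ + u)` is `⟨f, π(λ) π(u) g⟩`, so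
replacing it by its value at `λ` costs `⟨f, π(λ) h⟩` with `h = π(u) g - g` and `u ∈ Q`. If the total
cost is small, the integral is controlled by `vol Q · ∑ |⟨f, π(λ) g⟩|²`, which is the lower frame
bound (`enorm_sq_mul_le`).

Schur's test bounds `∑ |⟨f, π(λ) h⟩|²` by `‖f‖² ∑ |V_h h(λ)|` (`tsum_enorm_inner_tfShift_sq_le`);
with `h = g` this is also the upper bound. Since `Q` lies in the unit ball, `vol Q` times the
lattice sum is at most an integral that does not depend on the lattice (`volume_mul_tsum_le`). `V_h
h` inherits the decay of `V_g g`, and interpolation with `|V_h h| ≤ ‖h‖²` trades some of that decay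
for a power of `‖h‖`. This tends to `0` with `u` by strong continuity of `π`, and `‖A‖` controls the
diameter of `Q`. -/

/-! ### Plancherel's theorem and Moyal's identity -/

/-- The abstract `L²` transform and the Fourier integral define the same distribution: in both cases
the transform moves onto the test function. -/
theorem fourier_toLp_ae_eq {V : Type*} [NormedAddCommGroup V] [InnerProductSpace ℝ V]
    [FiniteDimensional ℝ V] [MeasurableSpace V] [BorelSpace V] {F : V → ℂ}
    (h1 : Integrable F) (h2 : MemLp F 2) :
    (𝓕 (h2.toLp F) : Lp ℂ 2 (volume : Measure V)) =ᵐ[volume] 𝓕 F := by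
  have hcont : Continuous (𝓕 F) :=
    VectorFourier.fourierIntegral_continuous Real.continuous_fourierChar
      (innerSL ℝ).continuous₂ h1
  refine ae_eq_of_integral_contDiff_smul_eq
    ((Lp.memLp _).locallyIntegrable (by norm_num)) hcont.locallyIntegrable ?_
  intro φ hφ hc
  have hφ' : ContDiff ℝ (⊤ : ℕ∞) (fun x => (φ x : ℂ)) := Complex.ofRealCLM.contDiff.comp hφ
  have hc' : HasCompactSupport (fun x => (φ x : ℂ)) :=
    hc.comp_left (g := fun r : ℝ => (r : ℂ)) (by simp)
  set ψ : SchwartzMap V ℂ := hc'.toSchwartzMap hφ' with hψ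
  have hψa : ∀ x, ψ x = (φ x : ℂ) := fun x => rfl
  have key := DFunLike.congr_fun (Lp.fourier_toTemperedDistribution_eq (h2.toLp F)) ψ
  rw [TemperedDistribution.fourier_apply, Lp.toTemperedDistribution_apply,
    Lp.toTemperedDistribution_apply] at key
  have e1 : ∫ x, φ x • (𝓕 (h2.toLp F) : Lp ℂ 2 (volume : Measure V)) x =
      ∫ x, ψ x • (𝓕 (h2.toLp F) : Lp ℂ 2 (volume : Measure V)) x := by
    simp [hψa]
  have e2 : ∫ x, (𝓕 ψ) x • (h2.toLp F) x = ∫ x, (𝓕 ψ) x • F x := by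
    refine integral_congr_ae ?_
    filter_upwards [h2.coeFn_toLp] with x hx
    rw [hx]
  have e3 : ∫ x, (𝓕 ψ) x • F x = ∫ x, ψ x • 𝓕 F x := by
    have := VectorFourier.integral_fourierIntegral_smul_eq_flip (L := innerₗ V)
      (μ := volume) (ν := volume) (f := ψ) (g := F) Real.continuous_fourierChar
      continuous_inner ψ.integrable h1
    rw [flip_innerₗ] at this
    exact this
  rw [e1, ← key, e2, e3]
  simp [hψa]

theorem lintegral_enorm_fourier_sq {V : Type*} [NormedAddCommGroup V] [InnerProductSpace ℝ V]
    [FiniteDimensional ℝ V] [MeasurableSpace V] [BorelSpace V] {F : V → ℂ}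
    (h1 : Integrable F) (h2 : MemLp F 2) :
    ∫⁻ ξ, ‖𝓕 F ξ‖ₑ ^ 2 = ∫⁻ t, ‖F t‖ₑ ^ 2 := by
  have h := Lp.norm_fourier_eq (h2.toLp F)
  have h' : eLpNorm (𝓕 F) 2 volume = eLpNorm F 2 volume := by
    rw [← eLpNorm_congr_ae (fourier_toLp_ae_eq h1 h2), ← eLpNorm_congr_ae h2.coeFn_toLp,
      ← Lp.enorm_def, ← Lp.enorm_def, ← ofReal_norm, ← ofReal_norm, h]
  have e : ∀ G : V → ℂ, ∫⁻ t, ‖G t‖ₑ ^ 2 = eLpNorm G 2 volume ^ (2 : ℝ) := fun G => by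
    have := eLpNorm_nnreal_pow_eq_lintegral (f := G) (μ := volume) (p := 2) (by norm_num)
    simpa using this.symm
  rw [e, e, h']

/-- The coordinates `(x, ξ)` of the time-frequency plane, as a measurable equivalence. -/
def Phase.prodEquiv (d : ℕ) : Phase d ≃ᵐ Space d × Space d :=
  (MeasurableEquiv.toLp 2 _).symm.trans <|
    (MeasurableEquiv.sumPiEquivProdPi (fun _ => ℝ)).trans <|
      MeasurableEquiv.prodCongr (MeasurableEquiv.toLp 2 _) (MeasurableEquiv.toLp 2 _)

theorem Phase.prodEquiv_apply {d : ℕ} (z : Phase d) :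
    Phase.prodEquiv d z = (z.time, z.freq) := rfl

theorem Phase.measurePreserving_prodEquiv (d : ℕ) :
    MeasurePreserving (Phase.prodEquiv d) volume volume := by
  refine (EuclideanSpace.volume_preserving_symm_measurableEquiv_toLp _).trans ?_
  refine (volume_measurePreserving_sumPiEquivProdPi _).trans ?_
  exact MeasurePreserving.prod (EuclideanSpace.volume_preserving_symm_measurableEquiv_toLp _).symm
    (EuclideanSpace.volume_preserving_symm_measurableEquiv_toLp _).symm

theorem stft_eq_fourier {d : ℕ} (g f : L2 d) (z : Phase d) :
    stft g f z = 𝓕 (fun t => f t * (starRingEnd ℂ) (g (t - z.time))) z.freq := by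
  rw [Real.fourier_eq', stft]
  congr 1 with t
  rw [smul_eq_mul, mul_comm, real_inner_comm]
  congr 2
  push_cast
  ring

theorem lintegral_enorm_sq {d : ℕ} (f : L2 d) : ∫⁻ t, ‖f t‖ₑ ^ 2 = ‖f‖ₑ ^ 2 := by
  have := eLpNorm_nnreal_pow_eq_lintegral (f := f) (μ := volume) (p := 2) (by norm_num)
  rw [Lp.enorm_def]
  simpa using this.symm

/-- Moyal's identity. -/
theorem lintegral_enorm_stft_sq {d : ℕ} (g f : L2 d) :
    ∫⁻ z, ‖stft g f z‖ₑ ^ 2 = ‖f‖ₑ ^ 2 * ‖g‖ₑ ^ 2 := by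
  have hf := (Lp.stronglyMeasurable f).measurable
  have hg := (Lp.stronglyMeasurable g).measurable
  set F : Space d → Space d → ℂ := fun x t => f t * (starRingEnd ℂ) (g (t - x)) with hF
  have hm : Measurable (fun p : Space d × Space d => 𝓕 (F p.1) p.2) := by
    refine StronglyMeasurable.measurable ?_
    simp only [Real.fourier_eq', hF]
    refine StronglyMeasurable.integral_prod_right
      (f := fun (p : Space d × Space d) (t : Space d) =>
        Complex.exp ((↑(-2 * Real.pi * inner ℝ t p.2) * Complex.I)) •
          (f t * (starRingEnd ℂ) (g (t - p.1)))) ?_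
    refine Measurable.stronglyMeasurable ?_
    refine Measurable.smul
      (Continuous.measurable (by fun_prop : Continuous fun q : (Space d × Space d) × Space d =>
        Complex.exp ((↑(-2 * Real.pi * inner ℝ q.2 q.1.2) * Complex.I)))) ?_
    exact (hf.comp measurable_snd).mul
      (Complex.continuous_conj.measurable.comp
        (hg.comp (measurable_snd.sub (measurable_fst.comp measurable_fst))))
  have e1 : ∫⁻ z, ‖stft g f z‖ₑ ^ 2 = ∫⁻ x, ∫⁻ ξ, ‖𝓕 (F x) ξ‖ₑ ^ 2 := by
    rw [← lintegral_prod (fun p : Space d × Space d => ‖𝓕 (F p.1) p.2‖ₑ ^ 2)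
      (hm.enorm.pow_const 2).aemeasurable]
    rw [← Measure.volume_eq_prod,
      ← (Phase.measurePreserving_prodEquiv d).lintegral_comp (hm.enorm.pow_const 2)]
    simp only [stft_eq_fourier, Phase.prodEquiv_apply, hF]
  have hFm : Measurable (fun p : Space d × Space d => F p.1 p.2) :=
    (hf.comp measurable_snd).mul
      (Complex.continuous_conj.measurable.comp (hg.comp (by fun_prop)))
  have e2 : ∫⁻ x, ∫⁻ t, ‖F x t‖ₑ ^ 2 = ‖f‖ₑ ^ 2 * ‖g‖ₑ ^ 2 := by
    rw [lintegral_lintegral_swap (hFm.enorm.pow_const 2).aemeasurable]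
    have : ∀ t, ∫⁻ x, ‖F x t‖ₑ ^ 2 = ‖f t‖ₑ ^ 2 * ‖g‖ₑ ^ 2 := fun t => by
      simp only [hF, enorm_mul, mul_pow, RCLike.enorm_conj]
      have hm' : Measurable fun x => ‖g (t - x)‖ₑ ^ 2 :=
        ((hg.comp (measurable_const.sub measurable_id)).enorm).pow_const 2
      rw [lintegral_const_mul _ hm',
        lintegral_sub_left_eq_self (fun x => ‖g x‖ₑ ^ 2) t, lintegral_enorm_sq]
    simp only [this]
    rw [lintegral_mul_const _ (hf.enorm.pow_const 2), lintegral_enorm_sq]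
  rw [e1, ← e2]
  -- A product of two `L²` functions is always integrable, but it is square integrable only for
  -- almost every `x`, by Tonelli; Plancherel is applied there.
  have hfin : ∀ᵐ x, ∫⁻ t, ‖F x t‖ₑ ^ 2 < ∞ := by
    refine ae_lt_top (Measurable.lintegral_prod_right (hFm.enorm.pow_const 2)) ?_
    rw [e2]
    exact ENNReal.mul_ne_top (by simp) (by simp)
  refine lintegral_congr_ae ?_
  filter_upwards [hfin] with x hx
  have hx1 : Integrable (F x) := by
    have hg' : MemLp (fun t => (starRingEnd ℂ) (g (t - x))) 2 volume :=
      ((Lp.memLp g).comp_measurePreserving (measurePreserving_sub_right volume x)).star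
    exact (Lp.memLp f).integrable_mul hg'
  refine lintegral_enorm_fourier_sq hx1 ⟨hx1.aestronglyMeasurable, ?_⟩
  rw [eLpNorm_lt_top_iff_lintegral_rpow_enorm_lt_top (by norm_num) (by norm_num)]
  simpa using hx

/-! ### Unitarity and composition of time-frequency shifts -/

theorem coeFn_tfShift {d : ℕ} (z : Phase d) (f : L2 d) :
    tfShift z f =ᵐ[volume] tfShiftFun z f :=
  MemLp.coeFn_toLp _

theorem tfShiftFun_ae_congr {d : ℕ} (z : Phase d) {f g : Space d → ℂ} (h : f =ᵐ[volume] g) :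
    tfShiftFun z f =ᵐ[volume] tfShiftFun z g := by
  filter_upwards [(measurePreserving_sub_right volume z.time).quasiMeasurePreserving.ae_eq_comp h]
    with t ht
  simp only [Function.comp_apply] at ht
  simp only [tfShiftFun, ht]

theorem conj_exp_phase (r : ℝ) :
    (starRingEnd ℂ) (Complex.exp (2 * Real.pi * Complex.I * (r : ℝ))) =
      Complex.exp (-(2 * Real.pi * Complex.I * (r : ℝ))) := by
  rw [← Complex.exp_conj]
  congr 1
  simp [map_ofNat (starRingEnd ℂ) 2]

theorem inner_tfShift {d : ℕ} (z : Phase d) (g f : L2 d) :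
    inner ℂ (tfShift z g) f = stft g f z := by
  rw [L2.inner_def, stft]
  refine integral_congr_ae ?_
  filter_upwards [coeFn_tfShift z g] with t ht
  rw [ht, RCLike.inner_apply, tfShiftFun, map_mul, conj_exp_phase]
  ring

theorem tfShift_sub {d : ℕ} (z : Phase d) (f g : L2 d) :
    tfShift z (f - g) = tfShift z f - tfShift z g := by
  refine Lp.ext ?_
  filter_upwards [coeFn_tfShift z (f - g), coeFn_tfShift z f, coeFn_tfShift z g,
    tfShiftFun_ae_congr z (Lp.coeFn_sub f g), Lp.coeFn_sub (tfShift z f) (tfShift z g)]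
    with t h1 h2 h3 h4 h5
  rw [h1, h4, h5, Pi.sub_apply, h2, h3]
  simp only [tfShiftFun, Pi.sub_apply]
  ring

theorem Phase.time_add {d : ℕ} (z w : Phase d) : (z + w).time = z.time + w.time := rfl

theorem Phase.freq_add {d : ℕ} (z w : Phase d) : (z + w).freq = z.freq + w.freq := rfl

theorem tfShift_tfShift {d : ℕ} (z w : Phase d) (f : L2 d) :
    tfShift z (tfShift w f) =
      Complex.exp (-(2 * Real.pi * Complex.I * (inner ℝ w.freq z.time : ℝ))) •
        tfShift (z + w) f := by
  refine Lp.ext ?_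
  filter_upwards [coeFn_tfShift z (tfShift w f), tfShiftFun_ae_congr z (coeFn_tfShift w f),
    coeFn_tfShift (z + w) f, Lp.coeFn_smul
      (Complex.exp (-(2 * Real.pi * Complex.I * (inner ℝ w.freq z.time : ℝ)))) (tfShift (z + w) f)]
    with t h1 h2 h3 h4
  rw [h1, h2, h4, Pi.smul_apply, h3]
  simp only [tfShiftFun, Phase.time_add, Phase.freq_add, inner_sub_right, inner_add_left,
    smul_eq_mul, sub_sub]
  rw [← mul_assoc, ← mul_assoc, ← Complex.exp_add, ← Complex.exp_add]
  congr 2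
  push_cast
  ring

theorem norm_exp_neg_phase (r : ℝ) :
    ‖Complex.exp (-(2 * Real.pi * Complex.I * (r : ℝ)))‖ = 1 := by
  rw [Complex.norm_exp]
  simp

theorem inner_tfShift_tfShift {d : ℕ} (z : Phase d) (f g : L2 d) :
    inner ℂ (tfShift z f) (tfShift z g) = inner ℂ f g := by
  rw [L2.inner_def, L2.inner_def, ← integral_sub_right_eq_self (μ := volume)
    (fun t => inner ℂ (f t) (g t)) z.time]
  refine integral_congr_ae ?_
  filter_upwards [coeFn_tfShift z f, coeFn_tfShift z g] with t h1 h2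
  rw [h1, h2]
  simp only [RCLike.inner_apply, tfShiftFun, map_mul, conj_exp_phase]
  rw [mul_mul_mul_comm, ← Complex.exp_add]
  simp

theorem norm_tfShift {d : ℕ} (z : Phase d) (f : L2 d) : ‖tfShift z f‖ = ‖f‖ := by
  rw [@norm_eq_sqrt_re_inner ℂ, inner_tfShift_tfShift, ← @norm_eq_sqrt_re_inner ℂ]

theorem norm_inner_tfShift_tfShift {d : ℕ} (z w : Phase d) (f g : L2 d) :
    ‖(inner ℂ (tfShift z f) (tfShift w g) : ℂ)‖ = ‖stft f g (z - w)‖ := by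
  have h := tfShift_tfShift w (z - w) f
  rw [add_sub_cancel] at h
  rw [← inner_tfShift, ← inner_tfShift_tfShift w (tfShift (z - w) f), h, inner_smul_left, norm_mul, RCLike.norm_conj,
    norm_exp_neg_phase, one_mul]

theorem norm_inner_tfShift_add {d : ℕ} (z w : Phase d) (g f : L2 d) :
    ‖(inner ℂ (tfShift z (tfShift w g)) f : ℂ)‖ = ‖stft g f (z + w)‖ := by
  rw [tfShift_tfShift, inner_smul_left, norm_mul, RCLike.norm_conj, norm_exp_neg_phase, one_mul,
    inner_tfShift]

/-! ### Strong continuity of time-frequency shifts at the origin -/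

/-- The phase-space point `(x, 0)`. -/
def Phase.ofTime {d : ℕ} (x : Space d) : Phase d := WithLp.toLp 2 (Sum.elim x 0)

/-- The phase-space point `(0, ξ)`. -/
def Phase.ofFreq {d : ℕ} (ξ : Space d) : Phase d := WithLp.toLp 2 (Sum.elim 0 ξ)

theorem Phase.ofFreq_add_ofTime {d : ℕ} (z : Phase d) :
    Phase.ofFreq z.freq + Phase.ofTime z.time = z := by
  ext i
  cases i <;> simp [Phase.ofFreq, Phase.ofTime, Phase.freq, Phase.time]

theorem tendsto_tfShift_ofTime {d : ℕ} (f : L2 d) :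
    Filter.Tendsto (fun x : Space d => tfShift (Phase.ofTime x) f) (𝓝 0) (𝓝 f) := by
  have h : ∀ x : Space d, tfShift (Phase.ofTime x) f = DomAddAct.mk (-x) +ᵥ f := fun x => by
    refine Lp.ext ?_
    filter_upwards [coeFn_tfShift (Phase.ofTime x) f, DomAddAct.vadd_Lp_ae_eq (DomAddAct.mk (-x)) f]
      with t h1 h2
    have hf : (Phase.ofTime x).freq = 0 := by ext i; simp [Phase.freq, Phase.ofTime]
    have ht : (Phase.ofTime x).time = x := by ext i; simp [Phase.time, Phase.ofTime]
    rw [h1, h2, tfShiftFun, hf, ht]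
    simp [sub_eq_neg_add]
  simp only [h]
  have : Fact ((2 : ℝ≥0∞) ≠ ∞) := ⟨by simp⟩
  have hc : Continuous fun x : Space d => (DomAddAct.mk (-x) +ᵥ f : L2 d) :=
    (DomAddAct.continuous_mk.comp continuous_neg).vadd continuous_const
  have := hc.tendsto 0
  rw [neg_zero] at this
  simpa using this

theorem norm_tfShift_sub_sq {d : ℕ} (z : Phase d) (f : L2 d) :
    ‖tfShift z f - f‖ ^ 2 = 2 * ‖f‖ ^ 2 - 2 * (stft f f z).re := by
  rw [@norm_sub_sq ℂ, norm_tfShift, inner_tfShift]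
  simp only [RCLike.re_eq_complex_re]
  ring

/-- By `norm_tfShift_sub_sq` this reduces to continuity at `0` of the Fourier transform of `|f|²`,
whose value there is `‖f‖²`. -/
theorem tendsto_tfShift_ofFreq {d : ℕ} (f : L2 d) :
    Filter.Tendsto (fun ξ : Space d => tfShift (Phase.ofFreq ξ) f) (𝓝 0) (𝓝 f) := by
  have hint : Integrable (fun t => f t * (starRingEnd ℂ) (f t)) :=
    (Lp.memLp f).integrable_mul (Lp.memLp f).star
  have hcont : Continuous (𝓕 (fun t => f t * (starRingEnd ℂ) (f t))) :=
    VectorFourier.fourierIntegral_continuous Real.continuous_fourierChar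
      (innerSL ℝ).continuous₂ hint
  have h : ∀ ξ : Space d, stft f f (Phase.ofFreq ξ) =
      𝓕 (fun t => f t * (starRingEnd ℂ) (f t)) ξ := fun ξ => by
    have hf : (Phase.ofFreq ξ).freq = ξ := by ext i; simp [Phase.freq, Phase.ofFreq]
    have ht : (Phase.ofFreq ξ).time = 0 := by ext i; simp [Phase.time, Phase.ofFreq]
    rw [stft_eq_fourier, hf, ht]
    simp only [sub_zero]
  have h0 : 𝓕 (fun t => f t * (starRingEnd ℂ) (f t)) 0 = ((‖f‖ ^ 2 : ℝ) : ℂ) := by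
    rw [Real.fourier_eq]
    have := @inner_self_eq_norm_sq_to_K ℂ _ _ _ _ f
    rw [L2.inner_def] at this
    simp only [RCLike.inner_apply] at this
    simpa using this
  rw [tendsto_iff_norm_sub_tendsto_zero]
  have hsq : Filter.Tendsto (fun ξ : Space d => ‖tfShift (Phase.ofFreq ξ) f - f‖ ^ 2) (𝓝 0)
      (𝓝 0) := by
    simp only [norm_tfShift_sub_sq, h]
    have h1 := ((Complex.continuous_re.comp hcont).tendsto 0)
    simp only [Function.comp_apply, Function.comp_def, h0, Complex.ofReal_re] at h1
    have h2 := (h1.const_mul 2).const_sub (2 * ‖f‖ ^ 2)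
    rwa [sub_self] at h2
  have := hsq.sqrt
  simpa using this

theorem tendsto_tfShift_zero {d : ℕ} (f : L2 d) :
    Filter.Tendsto (fun z : Phase d => ‖tfShift z f - f‖) (𝓝 0) (𝓝 0) := by
  have ht : Continuous (Phase.time : Phase d → Space d) := by
    unfold Phase.time; fun_prop
  have hf : Continuous (Phase.freq : Phase d → Space d) := by
    unfold Phase.freq; fun_prop
  have h1 := tendsto_iff_norm_sub_tendsto_zero.1
    ((tendsto_tfShift_ofTime f).comp (ht.tendsto 0))
  have h2 := tendsto_iff_norm_sub_tendsto_zero.1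
    ((tendsto_tfShift_ofFreq f).comp (hf.tendsto 0))
  have h12 := h1.add h2
  rw [add_zero] at h12
  refine squeeze_zero (fun _ => norm_nonneg _) (fun z => ?_) h12
  have h := tfShift_tfShift (Phase.ofFreq z.freq) (Phase.ofTime z.time) f
  have h0 : (Phase.ofTime z.time).freq = 0 := by ext i; simp [Phase.freq, Phase.ofTime]
  rw [h0, inner_zero_left, Phase.ofFreq_add_ofTime] at h
  simp only [Complex.ofReal_zero, mul_zero, neg_zero, Complex.exp_zero, one_smul] at h
  -- Factor `π(z)` as modulation after translation, without a phase; the modulation is isometric, so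
  -- the two errors add.
  calc ‖tfShift z f - f‖
      = ‖tfShift (Phase.ofFreq z.freq) (tfShift (Phase.ofTime z.time) f - f) +
          (tfShift (Phase.ofFreq z.freq) f - f)‖ := by
        rw [tfShift_sub, h]; congr 1; abel
    _ ≤ _ := (norm_add_le _ _).trans_eq (by rw [norm_tfShift]; rfl)

/-! ### Schur's test and Bessel bounds -/

/-- Schur's test for the Gram matrix of a finite family. -/
theorem sum_norm_inner_sq_le {ι H : Type*} [NormedAddCommGroup H] [InnerProductSpace ℂ H]
    (e : ι → H) {B : ℝ} (hB0 : 0 ≤ B) (s : Finset ι)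
    (hB : ∀ i ∈ s, ∑ j ∈ s, ‖(inner ℂ (e i) (e j) : ℂ)‖ ≤ B) (f : H) :
    ∑ i ∈ s, ‖(inner ℂ (e i) f : ℂ)‖ ^ 2 ≤ B * ‖f‖ ^ 2 := by
  set c : ι → ℂ := fun i => inner ℂ (e i) f with hc
  set v : H := ∑ i ∈ s, c i • e i with hv
  set N : ℝ := ∑ i ∈ s, ‖c i‖ ^ 2 with hN
  have hN0 : 0 ≤ N := Finset.sum_nonneg fun i _ => by positivity
  have hvf : (inner ℂ v f : ℂ) = (N : ℂ) := by
    rw [hv, sum_inner, hN, Complex.ofReal_sum]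
    refine Finset.sum_congr rfl fun i _ => ?_
    rw [inner_smul_left]
    change (starRingEnd ℂ) (c i) * c i = _
    rw [Complex.conj_mul']
    push_cast
    rfl
  have h1 : N ≤ ‖v‖ * ‖f‖ := by
    have := norm_inner_le_norm (𝕜 := ℂ) v f
    rwa [hvf, Complex.norm_real, Real.norm_of_nonneg hN0] at this
  have h2 : ‖v‖ ^ 2 ≤ B * N := by
    have hvv : (inner ℂ v v : ℂ) = ∑ i ∈ s, ∑ j ∈ s,
        (starRingEnd ℂ) (c i) * (c j * inner ℂ (e i) (e j)) := by
      rw [hv, sum_inner]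
      refine Finset.sum_congr rfl fun i _ => ?_
      rw [inner_sum]
      refine Finset.sum_congr rfl fun j _ => ?_
      rw [inner_smul_left, inner_smul_right]
    have hnv : ‖v‖ ^ 2 = ‖(inner ℂ v v : ℂ)‖ := by
      rw [inner_self_eq_norm_sq_to_K]; simp
    rw [hnv, hvv]
    calc ‖∑ i ∈ s, ∑ j ∈ s, (starRingEnd ℂ) (c i) * (c j * inner ℂ (e i) (e j))‖
        ≤ ∑ i ∈ s, ∑ j ∈ s, ‖c i‖ * (‖c j‖ * ‖(inner ℂ (e i) (e j) : ℂ)‖) := by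
          refine (norm_sum_le _ _).trans (Finset.sum_le_sum fun i _ => ?_)
          refine (norm_sum_le _ _).trans (Finset.sum_le_sum fun j _ => ?_)
          rw [norm_mul, norm_mul, RCLike.norm_conj]
      _ ≤ ∑ i ∈ s, ∑ j ∈ s, (‖c i‖ ^ 2 * ‖(inner ℂ (e i) (e j) : ℂ)‖ / 2 +
            ‖c j‖ ^ 2 * ‖(inner ℂ (e j) (e i) : ℂ)‖ / 2) := by
          -- The inequality `2ab ≤ a² + b²`, with the Gram entry transposed in the second half so
          -- that only row sums remain.
          refine Finset.sum_le_sum fun i _ => Finset.sum_le_sum fun j _ => ?_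
          rw [norm_inner_symm (e j) (e i)]
          nlinarith [mul_nonneg (sq_nonneg (‖c i‖ - ‖c j‖))
            (norm_nonneg (inner ℂ (e i) (e j) : ℂ))]
      _ = ∑ i ∈ s, ‖c i‖ ^ 2 * ∑ j ∈ s, ‖(inner ℂ (e i) (e j) : ℂ)‖ := by
          simp only [Finset.sum_add_distrib]
          rw [Finset.sum_comm (f := fun i j => ‖c j‖ ^ 2 * ‖(inner ℂ (e j) (e i) : ℂ)‖ / 2),
            ← Finset.sum_add_distrib]
          refine Finset.sum_congr rfl fun i _ => ?_
          rw [← Finset.sum_add_distrib, Finset.mul_sum]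
          exact Finset.sum_congr rfl fun j _ => by ring
      _ ≤ ∑ i ∈ s, ‖c i‖ ^ 2 * B :=
          Finset.sum_le_sum fun i hi => mul_le_mul_of_nonneg_left (hB i hi) (by positivity)
      _ = B * N := by rw [← Finset.sum_mul, mul_comm]
  change N ≤ B * ‖f‖ ^ 2
  rcases hN0.eq_or_lt with h | h
  · rw [← h]
    positivity
  · have h3 : N * N ≤ (B * ‖f‖ ^ 2) * N := by
      calc N * N ≤ (‖v‖ * ‖f‖) * (‖v‖ * ‖f‖) := by gcongr
        _ = ‖v‖ ^ 2 * ‖f‖ ^ 2 := by ring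
        _ ≤ (B * N) * ‖f‖ ^ 2 := by gcongr
        _ = _ := by ring
    exact le_of_mul_le_mul_right h3 h

/-- Schur's test: a uniform bound for the row sums of the Gram matrix is a Bessel bound. -/
theorem tsum_enorm_inner_sq_le {ι H : Type*} [NormedAddCommGroup H] [InnerProductSpace ℂ H]
    (e : ι → H) (B : ℝ≥0∞) (hB : ∀ i, ∑' j, ‖(inner ℂ (e i) (e j) : ℂ)‖ₑ ≤ B) (f : H) :
    ∑' i, ‖(inner ℂ (e i) f : ℂ)‖ₑ ^ 2 ≤ B * ‖f‖ₑ ^ 2 := by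
  rcases eq_or_ne f 0 with rfl | hf
  · simp
  rcases eq_or_ne B ∞ with rfl | hB'
  · rw [ENNReal.top_mul (by simpa using hf)]
    exact le_top
  lift B to NNReal using hB'
  rw [ENNReal.tsum_eq_iSup_sum]
  refine iSup_le fun s => ?_
  have h := sum_norm_inner_sq_le e B.coe_nonneg s (fun i _ => by
    have := (ENNReal.sum_le_tsum s).trans (hB i)
    simp only [enorm_eq_nnnorm, ← ENNReal.ofNNReal_finsetSum, ENNReal.coe_le_coe] at this
    rw [← NNReal.coe_le_coe] at this
    push_cast at this
    exact this) f
  simp only [enorm_eq_nnnorm]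
  norm_cast
  rw [← NNReal.coe_le_coe]
  push_cast
  exact h

/-- Gram entries depend in modulus only on the difference of the lattice points, so every row sum is
the same sum over `Λ`. -/
theorem tsum_enorm_inner_tfShift_sq_le {d : ℕ} (Λ : AddSubgroup (Phase d)) (h f : L2 d) :
    ∑' l : Λ, ‖(inner ℂ (tfShift (l : Phase d) h) f : ℂ)‖ₑ ^ 2 ≤
      (∑' l : Λ, ‖stft h h l‖ₑ) * ‖f‖ₑ ^ 2 := by
  refine tsum_enorm_inner_sq_le _ _ (fun l => le_of_eq ?_) f
  rw [← (Equiv.subLeft l).tsum_eq (fun l : Λ => ‖stft h h l‖ₑ)]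
  refine tsum_congr fun m => ?_
  rw [← ofReal_norm, ← ofReal_norm, norm_inner_tfShift_tfShift]
  rfl

/-! ### Decay estimates and lattice sums -/

/-- The pairing of a lattice sum with the volume of a fundamental domain of diameter at most one. -/
theorem volume_mul_tsum_le {d : ℕ} (Λ : AddSubgroup (Phase d)) [Countable Λ] (Q : Set (Phase d))
    (hQ : IsAddFundamentalDomain Λ Q volume) (hQ1 : ∀ u ∈ Q, ‖u‖ ≤ 1) {r : ℝ} (hr : 0 ≤ r) :
    volume Q * ∑' l : Λ, ENNReal.ofReal ((1 + ‖(l : Phase d)‖) ^ (-r)) ≤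
      ENNReal.ofReal (2 ^ r) * ∫⁻ z : Phase d, ENNReal.ofReal ((1 + ‖z‖) ^ (-r)) := by
  rw [hQ.lintegral_eq_tsum'', ← ENNReal.tsum_mul_left, ← ENNReal.tsum_mul_left]
  refine ENNReal.tsum_le_tsum fun l => ?_
  rw [← lintegral_const_mul _ (by fun_prop), mul_comm, ← setLIntegral_const]
  refine setLIntegral_mono ?_ fun u hu => ?_
  · simp only [AddSubgroup.vadd_def, vadd_eq_add]
    fun_prop
  · rw [← ENNReal.ofReal_mul (by positivity)]
    refine ENNReal.ofReal_le_ofReal ?_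
    have h1 : 1 + ‖l +ᵥ u‖ ≤ 2 * (1 + ‖(l : Phase d)‖) := by
      have : ‖(l : Phase d) + u‖ ≤ ‖(l : Phase d)‖ + 1 :=
        (norm_add_le _ _).trans (by gcongr; exact hQ1 u hu)
      change 1 + ‖(l : Phase d) + u‖ ≤ _
      linarith [norm_nonneg (l : Phase d)]
    have h2 := Real.rpow_le_rpow_of_nonpos (by positivity) h1 (neg_nonpos.2 hr)
    rw [Real.mul_rpow (by positivity) (by positivity)] at h2
    calc (1 + ‖(l : Phase d)‖) ^ (-r)
        = 2 ^ r * (2 ^ (-r) * (1 + ‖(l : Phase d)‖) ^ (-r)) := by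
          rw [← mul_assoc, ← Real.rpow_add (by norm_num)]; simp
      _ ≤ _ := by gcongr

theorem one_add_norm_rpow_neg_le {E : Type*} [NormedAddCommGroup E] {s : ℝ} (hs : 0 ≤ s)
    (z u : E) (hu : ‖u‖ ≤ 1) : (1 + ‖z + u‖) ^ (-s) ≤ 2 ^ s * (1 + ‖z‖) ^ (-s) := by
  have h1 : 1 + ‖z‖ ≤ 2 * (1 + ‖z + u‖) := by
    have : ‖z‖ ≤ ‖z + u‖ + ‖u‖ := by simpa using norm_sub_le (z + u) u
    linarith [norm_nonneg (z + u)]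
  have h2 := Real.rpow_le_rpow_of_nonpos (by positivity) h1 (neg_nonpos.2 hs)
  rw [Real.mul_rpow (by positivity) (by positivity)] at h2
  calc (1 + ‖z + u‖) ^ (-s) = 2 ^ s * (2 ^ (-s) * (1 + ‖z + u‖) ^ (-s)) := by
        rw [← mul_assoc, ← Real.rpow_add (by norm_num)]; simp
    _ ≤ _ := by gcongr

/-- Expanding both differences gives four terms, each a value of `|V_g g|` at `z` or `z ± u`; a
shift of length at most one costs the factor `2 ^ s`. -/
theorem norm_stft_tfShift_sub_le {d : ℕ} {g : L2 d} {s C : ℝ} (hs : 0 ≤ s)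
    (hg : ∀ z : Phase d, ‖stft g g z‖ ≤ C * (1 + ‖z‖) ^ (-s)) (u : Phase d) (hu : ‖u‖ ≤ 1)
    (z : Phase d) :
    ‖stft (tfShift u g - g) (tfShift u g - g) z‖ ≤ 4 * 2 ^ s * C * (1 + ‖z‖) ^ (-s) := by
  have hC : 0 ≤ C := by
    have := (norm_nonneg _).trans (hg 0)
    simpa using this
  have hbound : ∀ w : Phase d, ‖w‖ ≤ 1 → ‖stft g g (z + w)‖ ≤ 2 ^ s * C * (1 + ‖z‖) ^ (-s) :=
    fun w hw => (hg _).trans <| by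
      calc C * (1 + ‖z + w‖) ^ (-s) ≤ C * (2 ^ s * (1 + ‖z‖) ^ (-s)) := by
            gcongr; exact one_add_norm_rpow_neg_le hs z w hw
        _ = _ := by ring
  have t1 : ‖(inner ℂ (tfShift z (tfShift u g)) (tfShift u g) : ℂ)‖ = ‖stft g g (z + 0)‖ := by
    rw [tfShift_tfShift, inner_smul_left, norm_mul, RCLike.norm_conj, norm_exp_neg_phase, one_mul,
      norm_inner_tfShift_tfShift, add_sub_cancel_right, add_zero]
  have t2 : ‖(inner ℂ (tfShift z (tfShift u g)) g : ℂ)‖ = ‖stft g g (z + u)‖ :=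
    norm_inner_tfShift_add z u g g
  have t3 : ‖(inner ℂ (tfShift z g) (tfShift u g) : ℂ)‖ = ‖stft g g (z + -u)‖ := by
    rw [norm_inner_tfShift_tfShift, sub_eq_add_neg]
  have t4 : ‖(inner ℂ (tfShift z g) g : ℂ)‖ = ‖stft g g (z + 0)‖ := by
    rw [inner_tfShift, add_zero]
  have b1 := t1.trans_le (hbound 0 (by simp))
  have b2 := t2.trans_le (hbound u hu)
  have b3 := t3.trans_le (hbound (-u) (by simpa using hu))
  have b4 := t4.trans_le (hbound 0 (by simp))
  rw [← inner_tfShift, tfShift_sub, inner_sub_left, inner_sub_right, inner_sub_right]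
  refine (norm_sub_le _ _).trans ((add_le_add (norm_sub_le _ _) (norm_sub_le _ _)).trans ?_)
  linarith

/-- The parallelepiped spanned by the `2d` columns of `A`, each of norm at most `‖A‖`. -/
theorem exists_isAddFundamentalDomain_lattice {d : ℕ}
    (A : Matrix (Fin d ⊕ Fin d) (Fin d ⊕ Fin d) ℝ) (hA : IsUnit A) :
    ∃ Q : Set (Phase d), IsAddFundamentalDomain (lattice A) Q volume ∧ volume Q ≠ 0 ∧
      volume Q ≠ ∞ ∧ ∀ u ∈ Q, ‖u‖ ≤ 2 * d * ‖Matrix.toEuclideanCLM (𝕜 := ℝ) A‖ := by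
  set T := Matrix.toEuclideanCLM (𝕜 := ℝ) A with hT
  have hTu : IsUnit T := hA.map (Matrix.toEuclideanCLM (n := Fin d ⊕ Fin d) (𝕜 := ℝ))
  obtain ⟨e, he⟩ : ∃ e : Phase d ≃ₗ[ℝ] Phase d, ∀ x, e x = T x :=
    ⟨(ContinuousLinearEquiv.unitsEquiv ℝ (Phase d) hTu.unit).toLinearEquiv, fun x => rfl⟩
  set b : Module.Basis (Fin d ⊕ Fin d) ℝ (Phase d) :=
    (EuclideanSpace.basisFun (Fin d ⊕ Fin d) ℝ).toBasis.map e with hb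
  have hbi : ∀ i, b i = T (EuclideanSpace.single i 1) := fun i => by
    simp [hb, he]
  have hspan : lattice A = (Submodule.span ℤ (Set.range b)).toAddSubgroup := by
    ext z
    rw [Submodule.mem_toAddSubgroup, Submodule.mem_span_range_iff_exists_fun]
    refine exists_congr fun k => ?_
    have : ∑ i, k i • b i = T (WithLp.toLp 2 fun i => (k i : ℝ)) := by
      simp only [hbi, ← map_zsmul]
      rw [← map_sum]
      congr 1
      ext j
      cases j <;> simp [Pi.single_apply]
    rw [this, eq_comm]
  refine ⟨ZSpan.fundamentalDomain b, ?_, ZSpan.measure_fundamentalDomain_ne_zero b,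
    (ZSpan.fundamentalDomain_isBounded b).measure_lt_top.ne, fun u hu => ?_⟩
  · rw [hspan]
    exact ZSpan.isAddFundamentalDomain' b volume
  · rw [← (ZSpan.fract_eq_self (b := b)).2 hu]
    refine (ZSpan.norm_fract_le b u).trans ?_
    calc ∑ i, ‖b i‖ ≤ ∑ _i : Fin d ⊕ Fin d, ‖T‖ := Finset.sum_le_sum fun i _ => by
          rw [hbi]
          simpa using T.le_opNorm (EuclideanSpace.single i 1)
      _ = _ := by
          simp only [Finset.sum_const, Finset.card_univ, Fintype.card_sum, Fintype.card_fin,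
            nsmul_eq_mul]
          push_cast
          ring

instance countable_lattice {d : ℕ} (A : Matrix (Fin d ⊕ Fin d) (Fin d ⊕ Fin d) ℝ) :
    Countable (lattice A) := by
  have : (lattice A : Set (Phase d)) = Set.range fun k : Fin d ⊕ Fin d → ℤ =>
      Matrix.toEuclideanCLM (𝕜 := ℝ) A (WithLp.toLp 2 fun i => (k i : ℝ)) := by
    ext z
    exact exists_congr fun k => eq_comm
  have h : (lattice A : Set (Phase d)).Countable := this ▸ Set.countable_range _
  exact h.to_subtype

/-- The integral that controls the lattice sums of `(1 + |z|)^{-r}`. -/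
def weightIntegral (d : ℕ) (r : ℝ) : ℝ≥0∞ :=
  ENNReal.ofReal (2 ^ r) * ∫⁻ z : Phase d, ENNReal.ofReal ((1 + ‖z‖) ^ (-r))

theorem weightIntegral_ne_top {d : ℕ} {r : ℝ} (hr : 2 * (d : ℝ) < r) :
    weightIntegral d r ≠ ∞ := by
  refine ENNReal.mul_ne_top ENNReal.ofReal_ne_top (finite_integral_one_add_norm ?_).ne
  simpa [two_mul] using hr

theorem volume_mul_tsum_stft_le {d : ℕ} (Λ : AddSubgroup (Phase d)) [Countable Λ]
    (Q : Set (Phase d)) (hQ : IsAddFundamentalDomain Λ Q volume) (hQ1 : ∀ u ∈ Q, ‖u‖ ≤ 1)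
    {r : ℝ} (hr : 0 ≤ r) {c : ℝ} (hc : 0 ≤ c) {h : L2 d}
    (hh : ∀ z, ‖stft h h z‖ ≤ c * (1 + ‖z‖) ^ (-r)) :
    volume Q * ∑' l : Λ, ‖stft h h l‖ₑ ≤ ENNReal.ofReal c * weightIntegral d r := by
  calc volume Q * ∑' l : Λ, ‖stft h h l‖ₑ
      ≤ volume Q * ∑' l : Λ, ENNReal.ofReal c *
          ENNReal.ofReal ((1 + ‖(l : Phase d)‖) ^ (-r)) := by
        gcongr with l
        rw [← ENNReal.ofReal_mul hc, ← ofReal_norm]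
        exact ENNReal.ofReal_le_ofReal (hh l)
    _ = ENNReal.ofReal c *
          (volume Q * ∑' l : Λ, ENNReal.ofReal ((1 + ‖(l : Phase d)‖) ^ (-r))) := by
        rw [ENNReal.tsum_mul_left]; ring
    _ ≤ _ := by
        gcongr
        exact volume_mul_tsum_le Λ Q hQ hQ1 hr

theorem norm_stft_le {d : ℕ} (g f : L2 d) (z : Phase d) : ‖stft g f z‖ ≤ ‖g‖ * ‖f‖ := by
  rw [← inner_tfShift]
  simpa only [norm_tfShift] using norm_inner_le_norm (𝕜 := ℂ) (tfShift z g) f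

/-- Interpolation between the decay of `V_h h` and the trivial bound `‖h‖²`. -/
theorem norm_stft_le_interpolate {d : ℕ} {h : L2 d} {s c p : ℝ} (hc : 0 ≤ c)
    (hp0 : 0 < p) (hp1 : p < 1) {z : Phase d} (hh : ‖stft h h z‖ ≤ c * (1 + ‖z‖) ^ (-s)) :
    ‖stft h h z‖ ≤ ((‖h‖ ^ 2) ^ (1 - p) * c ^ p) * (1 + ‖z‖) ^ (-(s * p)) := by
  have h0 := norm_nonneg (stft h h z)
  calc ‖stft h h z‖ = ‖stft h h z‖ ^ (1 - p) * ‖stft h h z‖ ^ p := by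
        rw [← Real.rpow_add' h0 (by simp)]; simp
    _ ≤ (‖h‖ ^ 2) ^ (1 - p) * (c * (1 + ‖z‖) ^ (-s)) ^ p := by
        gcongr
        rw [sq]
        exact norm_stft_le h h z
    _ = _ := by
        rw [Real.mul_rpow hc (by positivity), ← Real.rpow_mul (by positivity)]
        ring_nf

/-! ### The frame inequalities -/

/-- This direction of the interchange needs no measurability of `F`, which spares a proof that the
error terms are measurable in `u`. -/
theorem tsum_setLIntegral_le {α ι : Type*} [MeasurableSpace α] (μ : Measure α) (F : ι → α → ℝ≥0∞) :
    ∑' i, ∫⁻ x, F i x ∂μ ≤ ∫⁻ x, ∑' i, F i x ∂μ := by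
  rw [ENNReal.tsum_eq_iSup_sum]
  refine iSup_le fun s => le_trans ?_ (lintegral_mono fun x => ENNReal.sum_le_tsum s)
  classical
  induction s using Finset.induction_on with
  | empty => simp
  | insert i s hi ih =>
    simp only [Finset.sum_insert hi]
    exact (add_le_add_right ih _).trans (le_lintegral_add _ _)

theorem enorm_stft_add_sq_le {d : ℕ} (g f : L2 d) (l u : Phase d) :
    ‖stft g f (l + u)‖ₑ ^ 2 ≤ 2 * ‖(inner ℂ (tfShift l g) f : ℂ)‖ₑ ^ 2 +
      2 * ‖(inner ℂ (tfShift l (tfShift u g - g)) f : ℂ)‖ₑ ^ 2 := by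
  have h : ‖stft g f (l + u)‖ ≤ ‖(inner ℂ (tfShift l g) f : ℂ)‖ +
      ‖(inner ℂ (tfShift l (tfShift u g - g)) f : ℂ)‖ := by
    rw [← norm_inner_tfShift_add]
    refine le_of_eq_of_le ?_ (norm_add_le _ _)
    rw [tfShift_sub, inner_sub_left]
    congr 1
    ring
  simp only [← ofReal_norm]
  have h0 := norm_nonneg (stft g f (l + u))
  have h1 := norm_nonneg (inner ℂ (tfShift l g) f : ℂ)
  have h2 := norm_nonneg (inner ℂ (tfShift l (tfShift u g - g)) f : ℂ)
  generalize ‖stft g f (l + u)‖ = x at *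
  generalize ‖(inner ℂ (tfShift l g) f : ℂ)‖ = y at *
  generalize ‖(inner ℂ (tfShift l (tfShift u g - g)) f : ℂ)‖ = w at *
  rw [← ENNReal.ofReal_pow h0, ← ENNReal.ofReal_pow h1, ← ENNReal.ofReal_pow h2,
    ← ENNReal.ofReal_ofNat 2, ← ENNReal.ofReal_mul (by norm_num),
    ← ENNReal.ofReal_mul (by norm_num), ← ENNReal.ofReal_add (by positivity) (by positivity)]
  refine ENNReal.ofReal_le_ofReal ?_
  nlinarith [sq_nonneg (y - w)]

/-- Moyal's identity over `Q`, the splitting `enorm_stft_add_sq_le`, and the Bessel bound for `π(u)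
g - g` integrated over `u ∈ Q`. -/
theorem enorm_sq_mul_le {d : ℕ} (Λ : AddSubgroup (Phase d)) [Countable Λ]
    (Q : Set (Phase d)) (hQ : IsAddFundamentalDomain Λ Q volume) (h0 : volume Q ≠ 0)
    (ht : volume Q ≠ ∞) (g : L2 d) {ε : ℝ≥0∞}
    (hε : ∀ u ∈ Q, volume Q * ∑' l : Λ, ‖stft (tfShift u g - g) (tfShift u g - g) l‖ₑ ≤ ε)
    (f : L2 d) :
    ‖f‖ₑ ^ 2 * ‖g‖ₑ ^ 2 ≤
      2 * volume Q * ∑' l : Λ, ‖(inner ℂ (tfShift (l : Phase d) g) f : ℂ)‖ₑ ^ 2 +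
        2 * (ε * ‖f‖ₑ ^ 2) := by
  have hsmall : ∑' l : Λ, ∫⁻ u in Q,
      ‖(inner ℂ (tfShift (l : Phase d) (tfShift u g - g)) f : ℂ)‖ₑ ^ 2 ≤ ε * ‖f‖ₑ ^ 2 := by
    refine (tsum_setLIntegral_le _ _).trans ?_
    calc ∫⁻ u in Q, ∑' l : Λ, ‖(inner ℂ (tfShift (l : Phase d) (tfShift u g - g)) f : ℂ)‖ₑ ^ 2
        ≤ ∫⁻ _u in Q, ε / volume Q * ‖f‖ₑ ^ 2 := by
          refine setLIntegral_mono measurable_const fun u hu => ?_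
          refine (tsum_enorm_inner_tfShift_sq_le Λ _ f).trans ?_
          gcongr
          rw [ENNReal.le_div_iff_mul_le (Or.inl h0) (Or.inl ht), mul_comm]
          exact hε u hu
      _ = ε * ‖f‖ₑ ^ 2 := by
          rw [setLIntegral_const, mul_right_comm, ENNReal.div_mul_cancel h0 ht]
  rw [← lintegral_enorm_stft_sq, hQ.lintegral_eq_tsum'']
  calc ∑' l : Λ, ∫⁻ u in Q, ‖stft g f (l +ᵥ u)‖ₑ ^ 2
      ≤ ∑' l : Λ, (2 * volume Q * ‖(inner ℂ (tfShift (l : Phase d) g) f : ℂ)‖ₑ ^ 2 +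
          2 * ∫⁻ u in Q, ‖(inner ℂ (tfShift (l : Phase d) (tfShift u g - g)) f : ℂ)‖ₑ ^ 2) := by
        refine ENNReal.tsum_le_tsum fun l => ?_
        refine (lintegral_mono fun u => enorm_stft_add_sq_le g f l u).trans_eq ?_
        rw [lintegral_add_left measurable_const, setLIntegral_const,
          lintegral_const_mul' _ _ (by simp)]
        ring
    _ ≤ _ := by
        rw [ENNReal.tsum_add, ENNReal.tsum_mul_left, ENNReal.tsum_mul_left]
        gcongr

theorem isFrame_gaborSystem {d : ℕ} (Λ : AddSubgroup (Phase d)) [Countable Λ]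
    (Q : Set (Phase d)) (hQ : IsAddFundamentalDomain Λ Q volume) (h0 : volume Q ≠ 0)
    (ht : volume Q ≠ ∞) {g : L2 d} (hg : g ≠ 0) (hK : ∑' l : Λ, ‖stft g g l‖ₑ ≠ ∞)
    (hε : ∀ u ∈ Q, volume Q * ∑' l : Λ, ‖stft (tfShift u g - g) (tfShift u g - g) l‖ₑ ≤
      ENNReal.ofReal (‖g‖ ^ 2 / 4)) :
    IsFrame (gaborSystem g Λ) := by
  set K := ∑' l : Λ, ‖stft g g l‖ₑ with hKdef
  have hg0 : 0 < ‖g‖ := norm_pos_iff.2 hg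
  have hv : 0 < (volume Q).toReal := ENNReal.toReal_pos h0 ht
  -- With error `‖g‖² / 4`, doubled, half of `‖f‖² ‖g‖²` survives; the remaining factor `2 vol Q`
  -- gives the lower constant. The `+ 1` makes positivity of the upper constant immediate.
  refine ⟨‖g‖ ^ 2 / (4 * (volume Q).toReal), K.toReal + 1, by positivity, by positivity,
    fun f => ?_⟩
  set a : Λ → ℝ := fun l => ‖(inner ℂ (gaborSystem g Λ l) f : ℂ)‖ ^ 2 with ha
  have ha0 : ∀ l, 0 ≤ a l := fun l => by positivity
  have hS : ∑' l : Λ, ‖(inner ℂ (tfShift (l : Phase d) g) f : ℂ)‖ₑ ^ 2 =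
      ∑' l, ENNReal.ofReal (a l) := tsum_congr fun l => by
    rw [← ofReal_norm, ← ENNReal.ofReal_pow (norm_nonneg _)]
    rfl
  have hup := tsum_enorm_inner_tfShift_sq_le Λ g f
  have hf2 : ‖f‖ₑ ^ 2 = ENNReal.ofReal (‖f‖ ^ 2) := by
    rw [← ofReal_norm, ENNReal.ofReal_pow (norm_nonneg _)]
  have hg2 : ‖g‖ₑ ^ 2 = ENNReal.ofReal (‖g‖ ^ 2) := by
    rw [← ofReal_norm, ENNReal.ofReal_pow (norm_nonneg _)]
  rw [hS, hf2] at hup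
  have hlt := ENNReal.mul_ne_top hK (ENNReal.ofReal_ne_top (r := ‖f‖ ^ 2))
  have hsum : Summable a := by
    have := ENNReal.summable_toReal (hup.trans_lt hlt.lt_top).ne
    simpa only [ENNReal.toReal_ofReal (ha0 _)] using this
  have hS0 : 0 ≤ ∑' l, a l := tsum_nonneg ha0
  rw [← ENNReal.ofReal_tsum_of_nonneg ha0 hsum] at hup
  have hlow := enorm_sq_mul_le Λ Q hQ h0 ht g hε f
  rw [hS, hf2, hg2, ← ENNReal.ofReal_tsum_of_nonneg ha0 hsum] at hlow
  refine ⟨hsum, ?_, ?_⟩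
  · have hlow' := ENNReal.toReal_mono (by finiteness) hlow
    rw [ENNReal.toReal_add (by finiteness) (by finiteness)] at hlow'
    simp only [ENNReal.toReal_mul, ENNReal.toReal_ofNat] at hlow'
    rw [ENNReal.toReal_ofReal (by positivity), ENNReal.toReal_ofReal (by positivity),
      ENNReal.toReal_ofReal hS0, ENNReal.toReal_ofReal (by positivity)] at hlow'
    change _ ≤ ∑' l, a l
    rw [div_mul_eq_mul_div, div_le_iff₀ (by positivity)]
    nlinarith
  · have hup' := ENNReal.toReal_mono hlt hup
    rw [ENNReal.toReal_mul, ENNReal.toReal_ofReal hS0, ENNReal.toReal_ofReal (by positivity)]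
      at hup'
    change ∑' l, a l ≤ _
    nlinarith [sq_nonneg ‖f‖]

theorem exists_forall_weight_small {d : ℕ} {g : L2 d} (hg : g ≠ 0) {p c M : ℝ} (hp : p < 1) :
    ∃ δ > 0, ∀ u : Phase d, ‖u‖ < δ →
      ((‖tfShift u g - g‖ ^ 2) ^ (1 - p) * c ^ p) * M ≤ ‖g‖ ^ 2 / 4 := by
  have h : Filter.Tendsto
      (fun u : Phase d => ((‖tfShift u g - g‖ ^ 2) ^ (1 - p) * c ^ p) * M) (𝓝 0) (𝓝 0) := by
    have h1 := (((tendsto_tfShift_zero g).pow 2).rpow_const (p := 1 - p)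
      (Or.inr (by linarith))).mul_const (c ^ p)
    have h2 := h1.mul_const M
    rwa [zero_pow two_ne_zero, Real.zero_rpow (by linarith), zero_mul, zero_mul] at h2
  have hpos : 0 < ‖g‖ ^ 2 / 4 := by
    have := norm_pos_iff.2 hg
    positivity
  obtain ⟨δ, hδ, H⟩ := Metric.eventually_nhds_iff.1 (h.eventually (gt_mem_nhds hpos))
  exact ⟨δ, hδ, fun u hu => (H (by simpa using hu)).le⟩

end Gabor

end

/-! ### Choice of the density threshold -/

theorem theoremt (d : ℕ) (g : Gabor.L2 d) (hg : g ≠ 0) (s : ℝ) (hs : 2 * (d : ℝ) < s)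
    (hgs : Gabor.MemModulation s g) :
    ∃ δ₀ : ℝ, 0 < δ₀ ∧
      ∀ A : Matrix (Fin d ⊕ Fin d) (Fin d ⊕ Fin d) ℝ, IsUnit A →
        ‖Matrix.toEuclideanCLM (𝕜 := ℝ) A‖ < δ₀ →
          Gabor.IsFrame (Gabor.gaborSystem g (Gabor.lattice A)) := by
  open Gabor MeasureTheory in
  obtain ⟨C, hC⟩ := hgs
  have hd : (0 : ℝ) ≤ d := d.cast_nonneg
  have hs0 : 0 < s := by linarith
  have hC0 : 0 ≤ C := by simpa using (norm_nonneg _).trans (hC 0)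
  -- This makes `s * p` the midpoint of `2d` and `s`: the interpolated weight stays integrable while
  -- `1 - p > 0` leaves a positive power of `‖h‖`.
  set p : ℝ := (2 * d + s) / (2 * s) with hp
  have hp0 : 0 < p := by positivity
  have hp1 : p < 1 := by rw [hp, div_lt_one (by positivity)]; linarith
  have hsp : 2 * (d : ℝ) < s * p := by
    have : s * p = (2 * d + s) / 2 := by rw [hp]; field_simp
    rw [this]; linarith
  set c : ℝ := 4 * 2 ^ s * C with hc
  have hc0 : 0 ≤ c := by positivity
  obtain ⟨δ, hδ, hsmall⟩ := exists_forall_weight_small hg (c := c)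
    (M := (weightIntegral d (s * p)).toReal) hp1
  -- Using `2d + 1` in place of the diameter factor `2d` keeps the denominator positive when `d =
  -- 0`.
  refine ⟨min δ 1 / (2 * d + 1), by positivity, fun A hA hAδ => ?_⟩
  obtain ⟨Q, hQ, h0, ht, hQb⟩ := exists_isAddFundamentalDomain_lattice A hA
  rw [lt_div_iff₀ (by positivity)] at hAδ
  have hQδ : ∀ u ∈ Q, ‖u‖ < min δ 1 := fun u hu => by
    -- The strict bound `2d ‖A‖ < (2d + 1) ‖A‖` requires `‖A‖ > 0`.
    rcases (norm_nonneg (Matrix.toEuclideanCLM (𝕜 := ℝ) A)).eq_or_lt with h | h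
    · refine (hQb u hu).trans_lt ?_
      rw [← h, mul_zero]
      positivity
    · refine (hQb u hu).trans_lt (lt_of_lt_of_le ?_ hAδ.le)
      nlinarith
  have hQ1 : ∀ u ∈ Q, ‖u‖ ≤ 1 := fun u hu => ((hQδ u hu).trans_le (min_le_right _ _)).le
  refine isFrame_gaborSystem (lattice A) Q hQ h0 ht hg ?_ fun u hu => ?_
  · have h := volume_mul_tsum_stft_le (lattice A) Q hQ hQ1 hs0.le hC0 hC
    have hfin := (h.trans_lt
      (ENNReal.mul_ne_top ENNReal.ofReal_ne_top (weightIntegral_ne_top hs)).lt_top).ne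
    intro htop
    rw [htop, ENNReal.mul_top h0] at hfin
    exact hfin rfl
  · refine (volume_mul_tsum_stft_le (lattice A) Q hQ hQ1 (by positivity) (by positivity) fun z =>
      norm_stft_le_interpolate hc0 hp0 hp1
        (norm_stft_tfShift_sub_le hs0.le hC u (hQ1 u hu) z)).trans ?_
    rw [← ENNReal.ofReal_toReal (weightIntegral_ne_top hsp), ← ENNReal.ofReal_mul (by positivity)]
    exact ENNReal.ofReal_le_ofReal (hsmall u ((hQδ u hu).trans_le (min_le_left _ _)))
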